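/- Let $B, C > 0$ and $p \in \mathbb{R}$, and let $\{\varphi^t\}_{t \ge 0}$ be the dynamical system on $\mathbb{R}^3$ generated by the Vallis (ENSO) system $$\dot x = By - C(x+p), \qquad \dot y = xz - y, \qquad \dot z = -xy - z + 1 .$$ Let $\mathcal{A}_{V}$ be its global B-attractor, i.e. the nonempty closed bounded set with $\varphi^t(\mathcal{A}_V) = \mathcal{A}_V$ for all $t \ge 0$ and $\lim_{t\to\infty} \sup_{v \in D} \operatorname{dist}(\varphi^t(v), \mathcal{A}_V) = 0$ for every bounded $D \subset \mathbb{R}^3$. For $t>0$ and $u \in \mathbb{R}^3$ let $\sigma_1 \ge \sigma_2 \ge \sigma_3$ be the singular values of the Jacobian matrix $D\varphi^t(u)$ (with respect to $u$), put $\omega_d = \sigma_1 \cdots \sigma_k\, \sigma_{k+1}^{d-k}$ with $k = \lfloor d \rfloor$ for $d \in [0,3)$ and $\omega_3 = \sigma_1\sigma_2\sigma_3$, and let $\dim_L(\varphi^t, u) = \max\{d \in [0,3] : \omega_d \ge 1\}$. Then the Lyapunov dimension $\dim_L \mathcal{A}_V = \inf_{t>0}\, \sup_{u \in \mathcal{A}_V}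 \dim_L(\varphi^t, u)$ satisfies $$\dim_L \mathcal{A}_V \le 3 - \frac{2(C+2)}{C+1+\sqrt{(C-1)^2 + \tfrac{25}{4}B}} .$$ -/

import Mathlib

noncomputable section

open Set Filter Topology

/-- The vector field of the Vallis (ENSO) system on `ℝ³`; the coordinates `0, 1, 2` of `u` are
`x, y, z`. -/
def vallisField (B C p : ℝ) (u : EuclideanSpace ℝ (Fin 3)) : EuclideanSpace ℝ (Fin 3) :=
  !₂[B * u 1 - C * (u 0 + p), u 0 * u 2 - u 1, -(u 0 * u 1) - u 2 + 1]

section Dynamics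

variable {E : Type*} [NormedAddCommGroup E] [NormedSpace ℝ E]

/-- `φ` (read only at times `t ≥ 0`) is the dynamical system `{φ^t}_{t ≥ 0}` on `E` generated by
the autonomous differential equation `u' = f u`: every `t ↦ φ t u` is the solution on `[0, ∞)`
that starts at `u`. For a locally Lipschitz `f` such a solution is unique, so that `φ t`, `t ≥ 0`,
is determined by `f`, and `φ (s + t) = φ s ∘ φ t` holds automatically. -/
structure IsDynamicalSystemOf (f : E → E) (φ : ℝ → E → E) : Prop where
  initial : ∀ u, φ 0 u = u
  solution : ∀ u, ∀ t, 0 ≤ t → HasDerivWithinAt (fun s => φ s u) (f (φ t u)) (Ici 0) t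

/-- `A` is the global B-attractor of the dynamical system `{φ^t}_{t ≥ 0}`: a nonempty closed
bounded set which is invariant, `φ^t(A) = A` for all `t ≥ 0`, and attracts every bounded set `D`
uniformly, i.e. `sup_{v ∈ D} dist (φ^t v, A) → 0` as `t → ∞`. (Such a set is unique, and it is the
smallest closed set attracting all bounded sets.) -/
structure IsGlobalBAttractor (φ : ℝ → E → E) (A : Set E) : Prop where
  nonempty : A.Nonempty
  isClosed : IsClosed A
  isBounded : Bornology.IsBounded A
  invariant : ∀ t, 0 ≤ t → φ t '' A = A
  attracts : ∀ D : Set E, Bornology.IsBounded D → ∀ ε : ℝ, 0 < ε →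
    ∀ᶠ t in atTop, φ t '' D ⊆ Metric.thickening ε A

end Dynamics

section LyapunovDimension

variable {E : Type*} [NormedAddCommGroup E] [InnerProductSpace ℝ E] [FiniteDimensional ℝ E]

/-- The singular value function `ω_d(T) = σ₁ ⋯ σ_k · σ_{k+1}^{d-k}`, `k = ⌊d⌋`, where
`σ₁ ≥ σ₂ ≥ ⋯` are the singular values of `T` (`σ_{i+1}` is `T.singularValues i`). -/
def singularValueFunction (T : E →ₗ[ℝ] E) (d : ℝ) : ℝ :=
  (∏ i ∈ Finset.range ⌊d⌋₊, T.singularValues i) * T.singularValues ⌊d⌋₊ ^ (d - ⌊d⌋₊)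

/-- The local Lyapunov dimension `max {d ∈ [0, n] | ω_d(Dg(u)) ≥ 1}` of a map `g` at the
point `u`, where `n` is the dimension of the space. -/
def localLyapunovDim (g : E → E) (u : E) : ℝ :=
  sSup {d : ℝ | 0 ≤ d ∧ d ≤ Module.finrank ℝ E ∧
    1 ≤ singularValueFunction (fderiv ℝ g u : E →ₗ[ℝ] E) d}

/-- The Lyapunov dimension `inf_{t > 0} sup_{u ∈ A} dim_L(φ^t, u)` of the set `A` with respect to
the dynamical system `{φ^t}_{t ≥ 0}`. -/
def lyapunovDim (φ : ℝ → E → E) (A : Set E) : ℝ :=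
  ⨅ t : Ioi (0 : ℝ), ⨆ u : A, localLyapunovDim (φ t) u

end LyapunovDimension

end

open Set Filter Topology Module

/-! Volume contracts at the constant rate `C + 2`, so `det Dφ^t = exp (-(C + 2) t)`
(`det_variational`). If every vector is stretched by at least `m`, then `ω_d * m ^ (3 - d) ≤ |det|`
(`singularValueFunction_mul_rpow_le`), so a lower bound on the smallest singular value bounds every
`d` with `ω_d ≥ 1`.

That bound comes from the disc `y² + z² ≤ 1` containing the attractor's `(y, z)`-projection: in the
norm `x²/B + y² + z²` vectors decay at rate at most `Λ = (C + 1 + √((C - 1)² + 4B)) / 2`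
(`neg_le_vallisJacobian`), hence `m = c exp (-Λ t)`. As `4 < 25/4`, the claimed bound leaves strict
room, which absorbs `c` at one large time; one time suffices for the infimum.

Differentiability of the flow is not assumed: `Dφ^t` is identified with the solution of the
variational equation. -/

/-- Differential form of Gronwall's inequality on `[0, T]`. -/
theorem le_exp_mul_of_deriv_le {q q' : ℝ → ℝ} {c T : ℝ}
    (hq : ∀ t ∈ Icc 0 T, HasDerivWithinAt q (q' t) (Ici 0) t)
    (hle : ∀ t ∈ Icc 0 T, q' t ≤ c * q t) {t : ℝ} (ht : t ∈ Icc 0 T) :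
    q t ≤ Real.exp (c * t) * q 0 := by
  have hd : ∀ s ∈ Icc 0 T, HasDerivWithinAt (fun s => Real.exp (-(c * s)) * q s)
      (Real.exp (-(c * s)) * (q' s - c * q s)) (Ici 0) s := by
    intro s hs
    have h1 : HasDerivAt (fun s => Real.exp (-(c * s))) (Real.exp (-(c * s)) * (-(c * 1))) s :=
      (((hasDerivAt_id s).const_mul c).neg).exp
    refine (h1.hasDerivWithinAt.mul (hq s hs)).congr_deriv ?_
    ring
  have hanti : AntitoneOn (fun s => Real.exp (-(c * s)) * q s) (Icc 0 T) := by
    refine antitoneOn_of_hasDerivWithinAt_nonpos (convex_Icc 0 T)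
      (f' := fun s => Real.exp (-(c * s)) * (q' s - c * q s)) ?_ ?_ ?_
    · intro s hs
      exact ((hd s hs).continuousWithinAt).mono Icc_subset_Ici_self
    · intro s hs
      exact (hd s (interior_subset hs)).mono (interior_subset.trans Icc_subset_Ici_self)
    · intro s hs
      have := hle s (interior_subset hs)
      exact mul_nonpos_of_nonneg_of_nonpos (Real.exp_pos _).le (by linarith)
  have h := hanti ⟨le_rfl, ht.1.trans ht.2⟩ ht ht.1
  simp only [mul_zero, neg_zero, Real.exp_zero, one_mul] at h
  calc q t = Real.exp (c * t) * (Real.exp (-(c * t)) * q t) := by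
        rw [← mul_assoc, ← Real.exp_add]; simp
    _ ≤ _ := by gcongr

/-! ### Linear equations on the half-line -/

section LinearODE

variable {E : Type*} [NormedAddCommGroup E] [NormedSpace ℝ E]

/-- The weight `exp (-2Ks)` beats the growth rate `K`, giving a Picard map with contraction factor
`1/2` on the whole half-line at once. -/
theorem norm_exp_smul_integral_le {L : ℝ → E →L[ℝ] E} {K : ℝ}
    (hbound : ∀ t, ‖L t‖ ≤ K) {g : ℝ → E} {D : ℝ} (hD : ∀ t, ‖g t‖ ≤ D) {s : ℝ} (hs : 0 ≤ s) :
    ‖Real.exp (-(2 * K * s)) • ∫ r in (0 : ℝ)..s, Real.exp (2 * K * r) • L r (g r)‖ ≤ D / 2 := by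
  have hD0 : 0 ≤ D := (norm_nonneg _).trans (hD 0)
  have hder : ∀ r : ℝ, HasDerivAt (fun r => D / 2 * Real.exp (2 * K * r))
      (K * D * Real.exp (2 * K * r)) r := by
    intro r
    refine ((((hasDerivAt_id r).const_mul (2 * K)).exp).const_mul (D / 2)).congr_deriv ?_
    simp only [id]; ring
  have hcont : Continuous fun r : ℝ => K * D * Real.exp (2 * K * r) := by fun_prop
  have hint := intervalIntegral.integral_eq_sub_of_hasDerivAt (a := 0) (b := s)
    (fun r _ => hder r) (hcont.intervalIntegrable _ _)
  have hle : ‖∫ r in (0 : ℝ)..s, Real.exp (2 * K * r) • L r (g r)‖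
      ≤ ∫ r in (0 : ℝ)..s, K * D * Real.exp (2 * K * r) := by
    refine intervalIntegral.norm_integral_le_of_norm_le hs ?_ (hcont.intervalIntegrable _ _)
    refine Eventually.of_forall fun r _ => ?_
    rw [norm_smul, Real.norm_of_nonneg (Real.exp_pos _).le, mul_comm]
    gcongr
    exact (L r).le_of_opNorm_le_of_le (hbound r) (hD r)
  rw [norm_smul, Real.norm_of_nonneg (Real.exp_pos _).le]
  calc _ ≤ Real.exp (-(2 * K * s)) * (D / 2 * Real.exp (2 * K * s)) := by
        gcongr
        refine hle.trans ?_
        rw [hint]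
        simp only [mul_zero, Real.exp_zero]
        linarith
    _ = D / 2 * (Real.exp (-(2 * K * s)) * Real.exp (2 * K * s)) := by ring
    _ = D / 2 := by rw [← Real.exp_add]; simp

/-- Global existence for a linear differential equation with bounded continuous coefficients. -/
theorem exists_hasDerivAt_linear [CompleteSpace E] {L : ℝ → E →L[ℝ] E} (hL : Continuous L) {K : ℝ}
    (hbound : ∀ t, ‖L t‖ ≤ K) (w₀ : E) :
    ∃ w : ℝ → E, w 0 = w₀ ∧ ∀ t, 0 ≤ t → HasDerivAt w (L t (w t)) t := by
  wlog hK : 0 < K generalizing K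
  · exact this (K := |K| + 1) (fun t => (hbound t).trans (by linarith [le_abs_self K])) (by positivity)
  have hc : ∀ g : BoundedContinuousFunction ℝ E,
      Continuous fun r : ℝ => Real.exp (2 * K * r) • L r (g r) := by
    intro g
    have := g.continuous
    exact Continuous.smul (by fun_prop) (hL.clm_apply this)
  have hc' : ∀ g : BoundedContinuousFunction ℝ E,
      Continuous fun t : ℝ => ∫ r in (0 : ℝ)..t, Real.exp (2 * K * r) • L r (g r) := fun g =>
    intervalIntegral.continuous_primitive (fun a b => (hc g).intervalIntegrable a b) 0
  -- Picard map for the rescaled unknown `g t = exp (-2Kt) • w t`; clamping time by `max t 0` keeps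
  -- `g` bounded and continuous on all of `ℝ`.
  let P : BoundedContinuousFunction ℝ E → BoundedContinuousFunction ℝ E := fun g =>
    BoundedContinuousFunction.ofNormedAddCommGroup
      (fun t => Real.exp (-(2 * K * max t 0)) •
        (w₀ + ∫ r in (0 : ℝ)..(max t 0), Real.exp (2 * K * r) • L r (g r)))
      (by
        have h1 : Continuous fun t : ℝ => max t 0 := by fun_prop
        have h2 := (hc' g).comp h1
        exact Continuous.smul (by fun_prop) (continuous_const.add h2))
      (‖w₀‖ + ‖g‖ / 2)
      (by
        intro t
        have hs : 0 ≤ max t 0 := le_max_right _ _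
        rw [smul_add]
        refine (norm_add_le _ _).trans (add_le_add ?_
          (norm_exp_smul_integral_le hbound g.norm_coe_le_norm hs))
        rw [norm_smul, Real.norm_of_nonneg (Real.exp_pos _).le]
        refine mul_le_of_le_one_left (norm_nonneg _) (Real.exp_le_one_iff.2 ?_)
        have : 0 ≤ 2 * K * max t 0 := by positivity
        linarith)
  have hP : ∀ g t, P g t = Real.exp (-(2 * K * max t 0)) •
        (w₀ + ∫ r in (0 : ℝ)..(max t 0), Real.exp (2 * K * r) • L r (g r)) := fun _ _ => rfl
  have hcontr : ContractingWith (1 / 2) P := by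
    refine ⟨by norm_num, LipschitzWith.of_dist_le_mul fun g h => ?_⟩
    rw [BoundedContinuousFunction.dist_le (by positivity)]
    intro t
    have hs : 0 ≤ max t 0 := le_max_right _ _
    rw [dist_eq_norm, hP, hP, ← smul_sub, add_sub_add_left_eq_sub,
      ← intervalIntegral.integral_sub ((hc g).intervalIntegrable _ _)
        ((hc h).intervalIntegrable _ _)]
    simp only [← smul_sub, ← map_sub]
    refine (norm_exp_smul_integral_le hbound (g := fun r => g r - h r) (D := dist g h)
      (fun r => ?_) hs).trans (le_of_eq ?_)
    · rw [← dist_eq_norm]; exact BoundedContinuousFunction.dist_coe_le_dist r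
    · push_cast; ring
  obtain ⟨g, hg⟩ : ∃ g, P g = g := ⟨_, hcontr.fixedPoint_isFixedPt⟩
  refine ⟨fun t => w₀ + ∫ r in (0 : ℝ)..t, Real.exp (2 * K * r) • L r (g r), by simp, ?_⟩
  intro t ht
  have hgt : g t = Real.exp (-(2 * K * t)) •
      (w₀ + ∫ r in (0 : ℝ)..t, Real.exp (2 * K * r) • L r (g r)) := by
    conv_lhs => rw [← hg, hP, max_eq_left ht]
  have hd := ((hc g).integral_hasStrictDerivAt 0 t).hasDerivAt.const_add w₀
  refine hd.congr_deriv ?_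
  rw [← map_smul, hgt, smul_smul, ← Real.exp_add]
  simp

end LinearODE

/-! ### Singular values and Lyapunov dimension -/

section SingularValues

variable {E : Type*} [NormedAddCommGroup E] [InnerProductSpace ℝ E] [FiniteDimensional ℝ E]

theorem LinearMap.le_singularValues {T : E →ₗ[ℝ] E} {m : ℝ}
    (hT : ∀ v, m * ‖v‖ ≤ ‖T v‖) {i : ℕ} (hi : i < finrank ℝ E) : m ≤ T.singularValues i := by
  obtain ⟨v, hv⟩ := (T.hasEigenvalue_adjoint_comp_self_sq_singularValues hi).exists_hasEigenvector
  have hv0 : 0 < ‖v‖ := norm_pos_iff.2 hv.2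
  have happ := hv.apply_eq_smul
  have h1 : ‖T v‖ ^ 2 = T.singularValues i ^ 2 * ‖v‖ ^ 2 := by
    rw [← real_inner_self_eq_norm_sq, ← LinearMap.adjoint_inner_left]
    rw [LinearMap.comp_apply] at happ
    rw [happ, real_inner_smul_left, real_inner_self_eq_norm_sq]
    simp
  have h2 : ‖T v‖ = T.singularValues i * ‖v‖ := by
    rw [← mul_pow] at h1
    exact (pow_left_inj₀ (norm_nonneg _) (mul_nonneg (T.singularValues_nonneg i) hv0.le)
      two_ne_zero).1 h1
  have h3 := hT v
  rw [h2] at h3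
  exact le_of_mul_le_mul_right h3 hv0

/-- `|det T|` is the product of all singular values; `ω_d` lacks factors of total exponent `n - d`,
each at least `m`. -/
theorem singularValueFunction_mul_rpow_le {T : E →ₗ[ℝ] E} {m : ℝ} (hm : 0 < m)
    (hT : ∀ v, m * ‖v‖ ≤ ‖T v‖) {d : ℝ} (hd0 : 0 ≤ d) (hd : d ≤ finrank ℝ E) :
    singularValueFunction T d * m ^ ((finrank ℝ E : ℝ) - d) ≤ |LinearMap.det T| := by
  rw [← T.normDet_eq_abs_det, T.normDet_eq_prod_singularValues, singularValueFunction]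
  set n := finrank ℝ E with hn
  have hfl : ((⌊d⌋₊ : ℕ) : ℝ) ≤ d := Nat.floor_le hd0
  have hlt : d < ⌊d⌋₊ + 1 := Nat.lt_floor_add_one d
  set k := ⌊d⌋₊ with hk
  rcases hd.lt_or_eq with hdn | hdn
  · have hkn : k < n := by exact_mod_cast hfl.trans_lt hdn
    have hσ : m ≤ T.singularValues k := LinearMap.le_singularValues hT hkn
    have hσ0 : 0 < T.singularValues k := hm.trans_le hσ
    have h1 : m ^ ((n : ℝ) - d) = m ^ ((k : ℝ) + 1 - d) * m ^ (n - (k + 1)) := by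
      rw [← Real.rpow_natCast, ← Real.rpow_add hm, Nat.cast_sub hkn]
      congr 1; push_cast; ring
    have h2 : T.singularValues k ^ (d - k) * m ^ ((k : ℝ) + 1 - d) ≤ T.singularValues k := by
      calc _ ≤ T.singularValues k ^ (d - k) * T.singularValues k ^ ((k : ℝ) + 1 - d) := by
            gcongr
        _ = T.singularValues k := by
            rw [← Real.rpow_add hσ0]
            convert Real.rpow_one _ using 2
            ring
    have h3 : m ^ (n - (k + 1)) ≤ ∏ i ∈ Finset.Ico (k + 1) n, T.singularValues i := by
      rw [← Nat.card_Ico, ← Finset.prod_const]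
      exact Finset.prod_le_prod (fun _ _ => hm.le) fun i hi =>
        LinearMap.le_singularValues hT (Finset.mem_Ico.1 hi).2
    have h4 : 0 ≤ ∏ i ∈ Finset.range k, T.singularValues i :=
      Finset.prod_nonneg fun i _ => T.singularValues_nonneg i
    calc _ = (∏ i ∈ Finset.range k, T.singularValues i) *
          ((T.singularValues k ^ (d - k) * m ^ ((k : ℝ) + 1 - d)) * m ^ (n - (k + 1))) := by
          rw [h1]; ring
      _ ≤ (∏ i ∈ Finset.range k, T.singularValues i) *
          (T.singularValues k * ∏ i ∈ Finset.Ico (k + 1) n, T.singularValues i) := by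
          gcongr
      _ = _ := by
          rw [← Finset.prod_range_mul_prod_Ico _ hkn.le, Finset.prod_eq_prod_Ico_succ_bot hkn]
  -- At `d = n` the index `k` lies past the last singular value, but its exponent is `0`.
  · have : k = n := by rw [hk, hdn, Nat.floor_natCast]
    rw [this, hdn]
    simp

theorem localLyapunovDim_nonneg (g : E → E) (u : E) : 0 ≤ localLyapunovDim g u :=
  Real.sSup_nonneg fun _ hd => hd.1

theorem localLyapunovDim_le {g : E → E} {u : E} {m κ : ℝ} (hm : 0 < m) (hκ : 0 ≤ κ)
    (hT : ∀ v, m * ‖v‖ ≤ ‖fderiv ℝ g u v‖)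
    (hdet : ∀ d : ℝ, κ < d → d ≤ finrank ℝ E →
      |LinearMap.det (fderiv ℝ g u : E →ₗ[ℝ] E)| < m ^ ((finrank ℝ E : ℝ) - d)) :
    localLyapunovDim g u ≤ κ := by
  refine Real.sSup_le (fun d ⟨hd0, hdn, hd⟩ => ?_) hκ
  by_contra! hlt
  have h1 := singularValueFunction_mul_rpow_le (T := (fderiv ℝ g u : E →ₗ[ℝ] E)) hm hT hd0 hdn
  have h2 := hdet d hlt hdn
  have h3 : 0 ≤ m ^ ((finrank ℝ E : ℝ) - d) := (Real.rpow_pos_of_pos hm _).le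
  nlinarith

theorem lyapunovDim_le {φ : ℝ → E → E} {A : Set E} (hA : A.Nonempty) {κ t : ℝ} (ht : 0 < t)
    (h : ∀ u ∈ A, localLyapunovDim (φ t) u ≤ κ) : lyapunovDim φ A ≤ κ := by
  have := hA.to_subtype
  refine (ciInf_le ⟨0, ?_⟩ (⟨t, ht⟩ : Ioi (0 : ℝ))).trans (ciSup_le fun u => h u u.2)
  rintro _ ⟨s, rfl⟩
  exact Real.iSup_nonneg fun u => localLyapunovDim_nonneg _ _

end SingularValues

/-! ### The Vallis field and its variational equation -/

noncomputable section Vallis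

local notation "E3" => EuclideanSpace ℝ (Fin 3)

theorem EuclideanSpace.hasDerivWithinAt_apply {ι : Type*} [Fintype ι]
    {w : ℝ → EuclideanSpace ℝ ι} {w' : EuclideanSpace ℝ ι} {s : Set ℝ} {t : ℝ}
    (h : HasDerivWithinAt w w' s t) (i : ι) : HasDerivWithinAt (fun s => w s i) (w' i) s t :=
  ((EuclideanSpace.proj (𝕜 := ℝ) i).hasFDerivAt.comp_hasDerivWithinAt t h :)

/-- The derivative of the Vallis vector field. -/
def vallisJacobian (B C : ℝ) (u : E3) : E3 →L[ℝ] E3 :=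
  LinearMap.toContinuousLinearMap
    { toFun := fun w => !₂[B * w 1 - C * w 0, u 2 * w 0 - w 1 + u 0 * w 2,
        -(u 1 * w 0) - u 0 * w 1 - w 2]
      map_add' := fun v w => by
        ext i; fin_cases i <;> simp <;> ring
      map_smul' := fun c w => by
        ext i; fin_cases i <;> simp <;> ring }

theorem vallisJacobian_apply (B C : ℝ) (u w : E3) :
    vallisJacobian B C u w = !₂[B * w 1 - C * w 0, u 2 * w 0 - w 1 + u 0 * w 2,
        -(u 1 * w 0) - u 0 * w 1 - w 2] := rfl

/-- The quadratic part of the Vallis vector field. -/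
def vallisQuadratic (e : E3) : E3 := !₂[0, e 0 * e 2, -(e 0 * e 1)]

theorem continuous_vallisJacobian (B C : ℝ) : Continuous (vallisJacobian B C) := by
  rw [continuous_clm_apply]
  intro w
  simp only [vallisJacobian_apply]
  refine (PiLp.continuous_toLp 2 _).comp (continuous_pi fun i => ?_)
  fin_cases i <;> simp <;> fun_prop

theorem vallisField_sub (B C p : ℝ) (u v : E3) :
    vallisField B C p v - vallisField B C p u
      = vallisJacobian B C u (v - u) + vallisQuadratic (v - u) := by
  ext i
  fin_cases i <;> simp [vallisField, vallisJacobian_apply, vallisQuadratic] <;> ring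

theorem norm_sq_eq_sum_three (e : E3) : ‖e‖ ^ 2 = e 0 ^ 2 + e 1 ^ 2 + e 2 ^ 2 := by
  rw [EuclideanSpace.real_norm_sq_eq, Fin.sum_univ_three]

/-- Because of this cancellation, the distance of two orbits is controlled by the Jacobian along one
of them, with no bound on the other. -/
theorem inner_vallisQuadratic (e : E3) : inner ℝ e (vallisQuadratic e) = 0 := by
  simp [PiLp.inner_apply, Fin.sum_univ_three, vallisQuadratic]; ring

theorem norm_vallisQuadratic_le (e : E3) : ‖vallisQuadratic e‖ ≤ ‖e‖ ^ 2 := by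
  refine le_of_sq_le_sq ?_ (by positivity)
  have h : ‖vallisQuadratic e‖ ^ 2 = e 0 ^ 2 * (e 1 ^ 2 + e 2 ^ 2) := by
    rw [norm_sq_eq_sum_three]; simp [vallisQuadratic]; ring
  rw [h, norm_sq_eq_sum_three]
  nlinarith [mul_nonneg (sq_nonneg (e 0)) (sq_nonneg (e 1)),
    mul_nonneg (sq_nonneg (e 0)) (sq_nonneg (e 2)), sq_nonneg (e 0 ^ 2),
    sq_nonneg (e 1 ^ 2 + e 2 ^ 2)]

variable {B C p : ℝ} {φ : ℝ → E3 → E3}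

theorem IsDynamicalSystemOf.exists_variational {K : ℝ} {u : E3}
    (hφ : IsDynamicalSystemOf (vallisField B C p) φ)
    (hK : ∀ t, 0 ≤ t → ‖vallisJacobian B C (φ t u)‖ ≤ K) :
    ∃ M : ℝ → E3 →L[ℝ] E3, M 0 = ContinuousLinearMap.id ℝ E3 ∧
      ∀ t, 0 ≤ t → HasDerivAt M (vallisJacobian B C (φ t u) ∘L M t) t := by
  have hcont : Continuous fun t : ℝ => φ (max t 0) u := by
    have h : ContinuousOn (fun s => φ s u) (Ici 0) := fun t ht =>
      (hφ.solution u t ht).continuousWithinAt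
    exact h.comp_continuous (by fun_prop) fun t => mem_Ici.2 (le_max_right _ _)
  let L : ℝ → (E3 →L[ℝ] E3) →L[ℝ] (E3 →L[ℝ] E3) := fun t =>
    ContinuousLinearMap.compL ℝ E3 E3 E3 (vallisJacobian B C (φ (max t 0) u))
  have hL : Continuous L :=
    (ContinuousLinearMap.compL ℝ E3 E3 E3).continuous.comp
      ((continuous_vallisJacobian B C).comp hcont)
  obtain ⟨M, hM0, hM⟩ := exists_hasDerivAt_linear hL (K := K) (fun t => by
    refine (ContinuousLinearMap.opNorm_le_bound _ (norm_nonneg _) fun S => ?_).trans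
      (hK _ (le_max_right t 0))
    exact ContinuousLinearMap.opNorm_comp_le _ _) (ContinuousLinearMap.id ℝ E3)
  refine ⟨M, hM0, fun t ht => ?_⟩
  have := hM t ht
  simpa [L, max_eq_left ht] using this

theorem IsDynamicalSystemOf.norm_sub_le {K : ℝ} {u : E3}
    (hφ : IsDynamicalSystemOf (vallisField B C p) φ)
    (hK : ∀ t, 0 ≤ t → ‖vallisJacobian B C (φ t u)‖ ≤ K) (v : E3) {t : ℝ} (ht : 0 ≤ t) :
    ‖φ t v - φ t u‖ ^ 2 ≤ Real.exp (2 * K * t) * ‖v - u‖ ^ 2 := by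
  have hder : ∀ s ∈ Icc 0 t, HasDerivWithinAt (fun s => ‖φ s v - φ s u‖ ^ 2)
      (2 * inner ℝ (φ s v - φ s u) (vallisField B C p (φ s v) - vallisField B C p (φ s u)))
      (Ici 0) s := fun s hs =>
    ((hφ.solution v s hs.1).sub (hφ.solution u s hs.1)).norm_sq
  have := le_exp_mul_of_deriv_le hder (c := 2 * K) (fun s hs => ?_) (t := t) ⟨ht, le_rfl⟩
  · simpa [hφ.initial] using this
  · rw [vallisField_sub, inner_add_right, inner_vallisQuadratic, add_zero]
    set e := φ s v - φ s u
    have h1 := real_inner_le_norm e (vallisJacobian B C (φ s u) e)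
    have h2 : ‖vallisJacobian B C (φ s u) e‖ ≤ K * ‖e‖ :=
      ContinuousLinearMap.le_of_opNorm_le _ (hK s hs.1) e
    nlinarith [norm_nonneg e]

/-- The solution operator of the variational equation is the derivative of the flow. -/
theorem IsDynamicalSystemOf.hasFDerivAt {K : ℝ} {u : E3}
    (hφ : IsDynamicalSystemOf (vallisField B C p) φ)
    (hK : ∀ t, 0 ≤ t → ‖vallisJacobian B C (φ t u)‖ ≤ K)
    {M : ℝ → E3 →L[ℝ] E3} (hM0 : M 0 = ContinuousLinearMap.id ℝ E3)
    (hM : ∀ t, 0 ≤ t → HasDerivAt M (vallisJacobian B C (φ t u) ∘L M t) t) {T : ℝ} (hT : 0 ≤ T) :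
    HasFDerivAt (φ T) (M T) u := by
  have hK0 : 0 ≤ K := (norm_nonneg _).trans (hK 0 le_rfl)
  set D := Real.exp (2 * K * T)
  have hkey : ∀ v, ‖φ T v - φ T u - M T (v - u)‖ ^ 2 ≤
      Real.exp ((2 * K + 1) * T) * (D * ‖v - u‖ ^ 2) ^ 2 := by
    intro v
    set R := D * ‖v - u‖ ^ 2 with hR
    let g : ℝ → E3 := fun s => φ s v - φ s u - M s (v - u)
    have hg : ∀ s ∈ Icc 0 T, HasDerivWithinAt g
        (vallisJacobian B C (φ s u) (g s) + vallisQuadratic (φ s v - φ s u)) (Ici 0) s := by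
      intro s hs
      have h1 := (hφ.solution v s hs.1).sub (hφ.solution u s hs.1)
      have h2 : HasDerivAt (fun s => M s (v - u))
          (vallisJacobian B C (φ s u) (M s (v - u))) s := by
        simpa using (hM s hs.1).clm_apply (hasDerivAt_const s (v - u))
      refine (h1.sub h2.hasDerivWithinAt).congr_deriv ?_
      rw [vallisField_sub, map_sub _ _ (M s (v - u))]
      abel
    -- Adding the constant `R ^ 2` makes the inequality homogeneous: the forcing term `2 ‖g‖ R` is
    -- at most `‖g‖² + R²`.
    have hder : ∀ s ∈ Icc 0 T, HasDerivWithinAt (fun s => ‖g s‖ ^ 2 + R ^ 2)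
        (2 * inner ℝ (g s) (vallisJacobian B C (φ s u) (g s) +
          vallisQuadratic (φ s v - φ s u))) (Ici 0) s := fun s hs =>
      ((hg s hs).norm_sq).add_const _
    have := le_exp_mul_of_deriv_le hder (c := 2 * K + 1) (fun s hs => ?_) (t := T) ⟨hT, le_rfl⟩
    · have hg0 : g 0 = 0 := by simp [g, hφ.initial, hM0]
      simp only [hg0, norm_zero] at this
      nlinarith [sq_nonneg R]
    · have h1 := real_inner_le_norm (g s) (vallisJacobian B C (φ s u) (g s))
      have h2 : ‖vallisJacobian B C (φ s u) (g s)‖ ≤ K * ‖g s‖ :=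
        ContinuousLinearMap.le_of_opNorm_le _ (hK s hs.1) _
      have h3 := real_inner_le_norm (g s) (vallisQuadratic (φ s v - φ s u))
      have h4 : ‖vallisQuadratic (φ s v - φ s u)‖ ≤ R := by
        refine (norm_vallisQuadratic_le _).trans ((hφ.norm_sub_le hK v hs.1).trans ?_)
        have : 2 * K * s ≤ 2 * K * T := by have := hs.2; gcongr
        rw [hR]
        gcongr
        exact Real.exp_le_exp.2 this
      rw [inner_add_right]
      have h5 : ‖g s‖ * ‖vallisJacobian B C (φ s u) (g s)‖ ≤ ‖g s‖ * (K * ‖g s‖) := by gcongr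
      have h6 : ‖g s‖ * ‖vallisQuadratic (φ s v - φ s u)‖ ≤ ‖g s‖ * R := by gcongr
      nlinarith [sq_nonneg (‖g s‖ - R), mul_nonneg hK0 (sq_nonneg R)]
  refine .of_isLittleO ?_
  have hO : (fun v => φ T v - φ T u - M T (v - u)) =O[𝓝 u] fun v => ‖v - u‖ ^ 2 := by
    refine Asymptotics.IsBigO.of_bound (√(Real.exp ((2 * K + 1) * T)) * D)
      (Eventually.of_forall fun v => ?_)
    rw [Real.norm_of_nonneg (by positivity)]
    refine le_of_sq_le_sq ((hkey v).trans (le_of_eq ?_)) (by positivity)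
    rw [mul_assoc, mul_pow √_, Real.sq_sqrt (Real.exp_pos _).le]
  refine hO.trans_isLittleO ?_
  have h0 : Tendsto (fun v : E3 => v - u) (𝓝 u) (𝓝 0) := by
    have : ContinuousAt (fun v : E3 => v - u) u := by fun_prop
    simpa [ContinuousAt] using this
  exact (Asymptotics.isLittleO_norm_pow_id (E' := E3) one_lt_two).comp_tendsto h0

/-! ### Volume contraction and localization of the attractor -/

theorem det_eq_of_fin_three (S : E3 →L[ℝ] E3) (a b c : E3)
    (ha : S (EuclideanSpace.single 0 1) = a) (hb : S (EuclideanSpace.single 1 1) = b)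
    (hc : S (EuclideanSpace.single 2 1) = c) :
    LinearMap.det (S : E3 →ₗ[ℝ] E3) = a 0 * (b 1 * c 2 - c 1 * b 2)
      - b 0 * (a 1 * c 2 - c 1 * a 2) + c 0 * (a 1 * b 2 - b 1 * a 2) := by
  rw [← LinearMap.det_toMatrix (EuclideanSpace.basisFun (Fin 3) ℝ).toBasis, Matrix.det_fin_three]
  simp [LinearMap.toMatrix_apply, ha, hb, hc]
  ring

/-- Liouville's formula for the variational equation. -/
theorem det_variational {γ : ℝ → E3} {M : ℝ → E3 →L[ℝ] E3}
    (hM0 : M 0 = ContinuousLinearMap.id ℝ E3)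
    (hM : ∀ t, 0 ≤ t → HasDerivAt M (vallisJacobian B C (γ t) ∘L M t) t) {t : ℝ} (ht : 0 ≤ t) :
    LinearMap.det (M t : E3 →ₗ[ℝ] E3) = Real.exp (-(C + 2) * t) := by
  let a : ℝ → E3 := fun t => M t (EuclideanSpace.single 0 1)
  let b : ℝ → E3 := fun t => M t (EuclideanSpace.single 1 1)
  let c : ℝ → E3 := fun t => M t (EuclideanSpace.single 2 1)
  have hcol : ∀ v : E3, ∀ s, 0 ≤ s → ∀ i, HasDerivWithinAt (fun s => M s v i)
      (vallisJacobian B C (γ s) (M s v) i) (Ici 0) s := by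
    intro v s hs
    have h2 : HasDerivAt (fun s => M s v) (vallisJacobian B C (γ s) (M s v)) s := by
      simpa using (hM s hs).clm_apply (hasDerivAt_const s v)
    exact EuclideanSpace.hasDerivWithinAt_apply h2.hasDerivWithinAt
  have hder : ∀ s, 0 ≤ s → HasDerivWithinAt (fun s => LinearMap.det (M s : E3 →ₗ[ℝ] E3))
      (-(C + 2) * LinearMap.det (M s : E3 →ₗ[ℝ] E3)) (Ici 0) s := by
    intro s hs
    simp only [fun s => det_eq_of_fin_three (M s) (a s) (b s) (c s) rfl rfl rfl]
    have ha := hcol (EuclideanSpace.single 0 1) s hs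
    have hb := hcol (EuclideanSpace.single 1 1) s hs
    have hc := hcol (EuclideanSpace.single 2 1) s hs
    refine ((((ha 0).mul (((hb 1).mul (hc 2)).sub ((hc 1).mul (hb 2)))).sub
      ((hb 0).mul (((ha 1).mul (hc 2)).sub ((hc 1).mul (ha 2))))).add
      ((hc 0).mul (((ha 1).mul (hb 2)).sub ((hb 1).mul (ha 2))))).congr_deriv ?_
    simp [vallisJacobian_apply, a, b, c]
    ring
  have h0 : LinearMap.det (M 0 : E3 →ₗ[ℝ] E3) = 1 := by simp [hM0]
  have hle := le_exp_mul_of_deriv_le (T := t) (fun s hs => hder s hs.1) (fun s _ => le_rfl)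
    ⟨ht, le_rfl⟩
  -- Gronwall for the determinant and for its negative together give equality.
  have hge := le_exp_mul_of_deriv_le (T := t) (c := -(C + 2)) (fun s hs => (hder s hs.1).neg)
    (fun s _ => by simp) ⟨ht, le_rfl⟩
  simp only [Pi.neg_apply] at hge
  rw [h0] at hle hge
  linarith

/-- On the attractor the last two coordinates lie in the closed unit disc. -/
theorem IsGlobalBAttractor.sq_add_sq_le_one {A : Set E3}
    (hφ : IsDynamicalSystemOf (vallisField B C p) φ) (hA : IsGlobalBAttractor φ A) {u : E3}
    (hu : u ∈ A) : u 1 ^ 2 + u 2 ^ 2 ≤ 1 := by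
  obtain ⟨R, hR⟩ := hA.isBounded.exists_norm_le
  have hbound : ∀ t, 0 ≤ t → u 1 ^ 2 + u 2 ^ 2 - 1 ≤ Real.exp (-1 * t) * R ^ 2 := by
    intro t ht
    -- Pull `u` back along the flow by an arbitrary time: the preimage stays in the bounded set `A`,
    -- while the excess over `1` decays like `exp (-t)`.
    obtain ⟨v, hv, rfl⟩ : u ∈ φ t '' A := by rw [hA.invariant t ht]; exact hu
    have hder : ∀ s ∈ Icc 0 t, HasDerivWithinAt (fun s => φ s v 1 ^ 2 + φ s v 2 ^ 2 - 1)
        (2 * (φ s v 2 - φ s v 1 ^ 2 - φ s v 2 ^ 2)) (Ici 0) s := by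
      intro s hs
      have h := EuclideanSpace.hasDerivWithinAt_apply (hφ.solution v s hs.1)
      refine ((((h 1).pow 2).add ((h 2).pow 2)).sub_const 1).congr_deriv ?_
      simp [vallisField]
      ring
    have h1 := le_exp_mul_of_deriv_le hder (c := -1) (fun s _ => by
      nlinarith [sq_nonneg (φ s v 2 - 1), sq_nonneg (φ s v 1)]) ⟨ht, le_rfl⟩
    refine h1.trans ?_
    rw [hφ.initial]
    gcongr
    have h2 : ‖v‖ ^ 2 ≤ R ^ 2 := by have := hR v hv; gcongr
    rw [norm_sq_eq_sum_three] at h2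
    nlinarith [sq_nonneg (v 0)]
  have hlim : Tendsto (fun t : ℝ => Real.exp (-1 * t) * R ^ 2) atTop (𝓝 (0 * R ^ 2)) := by
    refine Tendsto.mul_const _ ?_
    simpa using Real.tendsto_exp_neg_atTop_nhds_zero
  have := ge_of_tendsto hlim (eventually_atTop.2 ⟨0, hbound⟩)
  linarith

theorem IsGlobalBAttractor.mem_of_mem {A : Set E3} (hA : IsGlobalBAttractor φ A) {u : E3}
    (hu : u ∈ A) {t : ℝ} (ht : 0 ≤ t) : φ t u ∈ A := by
  rw [← hA.invariant t ht]
  exact mem_image_of_mem _ hu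

/-! ### Lower bound for the smallest singular value -/

/-- The norm adapted to the Vallis system, squared. -/
def vallisNormSq (B : ℝ) (w : E3) : ℝ := w 0 ^ 2 / B + w 1 ^ 2 + w 2 ^ 2

/-- Lower bound for the symmetric part of the Jacobian in the adapted norm; here `-Λ` is the least
eigenvalue of the corresponding comparison matrix. -/
theorem neg_le_vallisJacobian (hB : 0 < B) {Λ : ℝ} (hΛC : C < Λ) (hΛ : (Λ - C) * (Λ - 1) = B)
    {u : E3} (hu : u 1 ^ 2 + u 2 ^ 2 ≤ 1) (w : E3) :
    -Λ * vallisNormSq B w ≤ w 0 * vallisJacobian B C u w 0 / B + w 1 * vallisJacobian B C u w 1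
      + w 2 * vallisJacobian B C u w 2 := by
  simp only [vallisJacobian_apply, vallisNormSq]
  simp
  -- With weight `1/B` all coupling is `w 0 * q`; the terms in `u 0` cancel, so no bound on `x` is
  -- needed.
  set q := (1 + u 2) * w 1 - u 1 * w 2 with hq
  have hqle : q ^ 2 ≤ 4 * (w 1 ^ 2 + w 2 ^ 2) := by
    have h1 : q ^ 2 ≤ ((1 + u 2) ^ 2 + u 1 ^ 2) * (w 1 ^ 2 + w 2 ^ 2) := by
      nlinarith [sq_nonneg ((1 + u 2) * w 2 + u 1 * w 1)]
    have h2 : (1 + u 2) ^ 2 + u 1 ^ 2 ≤ 4 := by nlinarith [sq_nonneg (u 1)]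
    exact h1.trans (by gcongr)
  have hpos : 0 < Λ - C := by linarith
  have h3 : 0 ≤ (Λ - C) * w 0 ^ 2 / B + (Λ - 1) * (w 1 ^ 2 + w 2 ^ 2) + w 0 * q := by
    have h4 : (Λ - 1) = B / (Λ - C) := by field_simp; linarith
    -- Complete the square in `w 0`; `(Λ - C) * (Λ - 1) = B` makes the remainder a multiple of `4 (w
    -- 1 ^ 2 + w 2 ^ 2) - q ^ 2`.
    have h5 : (Λ - C) * w 0 ^ 2 / B + (Λ - 1) * (w 1 ^ 2 + w 2 ^ 2) + w 0 * q
        = (Λ - C) / B * (w 0 + B / (2 * (Λ - C)) * q) ^ 2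
          + B / (4 * (Λ - C)) * (4 * (w 1 ^ 2 + w 2 ^ 2) - q ^ 2) := by
      rw [h4]; field_simp; ring
    rw [h5]
    have : 0 ≤ 4 * (w 1 ^ 2 + w 2 ^ 2) - q ^ 2 := by linarith
    positivity
  have h6 : w 0 * (B * w 1 - C * w 0) / B = w 0 * w 1 - C * w 0 ^ 2 / B := by field_simp
  have h7 : (Λ - C) * w 0 ^ 2 / B = Λ * (w 0 ^ 2 / B) - C * w 0 ^ 2 / B := by ring
  rw [h6]
  rw [h7] at h3
  linarith [show w 0 * q = w 0 * w 1 + w 0 * u 2 * w 1 - w 0 * u 1 * w 2 by rw [hq]; ring]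

theorem exp_mul_vallisNormSq_le (hB : 0 < B) {Λ : ℝ} (hΛC : C < Λ)
    (hΛ : (Λ - C) * (Λ - 1) = B) {γ : ℝ → E3} (hγ : ∀ t, 0 ≤ t → γ t 1 ^ 2 + γ t 2 ^ 2 ≤ 1)
    {M : ℝ → E3 →L[ℝ] E3} (hM0 : M 0 = ContinuousLinearMap.id ℝ E3)
    (hM : ∀ t, 0 ≤ t → HasDerivAt M (vallisJacobian B C (γ t) ∘L M t) t) {t : ℝ} (ht : 0 ≤ t)
    (v : E3) : Real.exp (-(2 * Λ) * t) * vallisNormSq B v ≤ vallisNormSq B (M t v) := by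
  have hder : ∀ s ∈ Icc 0 t, HasDerivWithinAt (fun s => -vallisNormSq B (M s v))
      (-(2 * (M s v 0 * vallisJacobian B C (γ s) (M s v) 0 / B
        + M s v 1 * vallisJacobian B C (γ s) (M s v) 1
        + M s v 2 * vallisJacobian B C (γ s) (M s v) 2))) (Ici 0) s := by
    intro s hs
    have h2 : HasDerivAt (fun s => M s v) (vallisJacobian B C (γ s) (M s v)) s := by
      simpa using (hM s hs.1).clm_apply (hasDerivAt_const s v)
    have h := EuclideanSpace.hasDerivWithinAt_apply (h2.hasDerivWithinAt (s := Ici 0))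
    refine (((((h 0).pow 2).div_const B).add ((h 1).pow 2)).add ((h 2).pow 2)).neg.congr_deriv ?_
    simp
    ring
  have := le_exp_mul_of_deriv_le hder (c := -(2 * Λ)) (fun s hs => by
    have := neg_le_vallisJacobian hB hΛC hΛ (hγ s hs.1) (M s v)
    linarith) ⟨ht, le_rfl⟩
  simp only [hM0, ContinuousLinearMap.id_apply] at this
  linarith

/-- The two norms are equivalent; `c` is not sharp, only its independence of `r` matters. -/
theorem exists_norm_le_of_vallisNormSq_le (hB : 0 < B) : ∃ c : ℝ, 0 < c ∧ c ≤ 1 ∧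
    ∀ r : ℝ, 0 ≤ r → ∀ v w : E3, r ^ 2 * vallisNormSq B v ≤ vallisNormSq B w →
      c * r * ‖v‖ ≤ ‖w‖ := by
  refine ⟨min B 1 / max B 1, by positivity,
    div_le_one_of_le₀ (min_le_right _ _ |>.trans (le_max_right _ _)) (by positivity), ?_⟩
  intro r hr v w h
  set m := min B 1 with hm
  set n := max B 1 with hn
  have hm0 : 0 < m := by positivity
  have hn0 : 0 < n := by positivity
  have hmB : m ≤ B := min_le_left _ _
  have hm1 : m ≤ 1 := min_le_right _ _
  have hnB : B ≤ n := le_max_left _ _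
  have hn1 : 1 ≤ n := le_max_right _ _
  have hlow : ‖v‖ ^ 2 ≤ n * vallisNormSq B v := by
    rw [norm_sq_eq_sum_three, vallisNormSq]
    have : v 0 ^ 2 ≤ n * (v 0 ^ 2 / B) := by
      rw [mul_div_assoc', le_div_iff₀ hB, mul_comm]; gcongr
    nlinarith [sq_nonneg (v 1), sq_nonneg (v 2)]
  have hup : m * vallisNormSq B w ≤ ‖w‖ ^ 2 := by
    rw [norm_sq_eq_sum_three, vallisNormSq]
    have : m * (w 0 ^ 2 / B) ≤ w 0 ^ 2 := by
      rw [mul_div_assoc', div_le_iff₀ hB, mul_comm]; gcongr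
    nlinarith [sq_nonneg (w 1), sq_nonneg (w 2)]
  refine le_of_sq_le_sq ?_ (norm_nonneg _)
  have hmn : (m / n) ^ 2 ≤ m / n := by
    have h1 : m / n ≤ 1 := div_le_one_of_le₀ (hm1.trans hn1) hn0.le
    have h0 : 0 ≤ m / n := by positivity
    nlinarith
  calc (m / n * r * ‖v‖) ^ 2 = (m / n) ^ 2 * (r ^ 2 * ‖v‖ ^ 2) := by ring
    _ ≤ m / n * (r ^ 2 * (n * vallisNormSq B v)) := by gcongr
    _ = m * (r ^ 2 * vallisNormSq B v) := by field_simp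
    _ ≤ m * vallisNormSq B w := by gcongr
    _ ≤ ‖w‖ ^ 2 := hup

/-- For `u` on the attractor, `Dφ^t(u)` has determinant `exp (-(C + 2) t)` and expands all vectors
at least by `c exp (-Λ t)`. -/
theorem exists_forall_le_norm_fderiv {A : Set E3} (hB : 0 < B) {Λ : ℝ} (hΛC : C < Λ)
    (hΛ : (Λ - C) * (Λ - 1) = B) (hφ : IsDynamicalSystemOf (vallisField B C p) φ)
    (hA : IsGlobalBAttractor φ A) :
    ∃ c : ℝ, 0 < c ∧ c ≤ 1 ∧ ∀ u ∈ A, ∀ t, 0 ≤ t →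
      LinearMap.det (fderiv ℝ (φ t) u : E3 →ₗ[ℝ] E3) = Real.exp (-(C + 2) * t) ∧
      ∀ v, c * Real.exp (-Λ * t) * ‖v‖ ≤ ‖fderiv ℝ (φ t) u v‖ := by
  obtain ⟨c, hc0, hc1, hc⟩ := exists_norm_le_of_vallisNormSq_le hB
  refine ⟨c, hc0, hc1, fun u hu t ht => ?_⟩
  have hcomp : IsCompact A := Metric.isCompact_of_isClosed_isBounded hA.isClosed hA.isBounded
  obtain ⟨K, hK⟩ := hcomp.exists_bound_of_continuousOn
    (continuous_vallisJacobian B C).continuousOn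
  have hK' : ∀ t, 0 ≤ t → ‖vallisJacobian B C (φ t u)‖ ≤ K := fun t ht =>
    hK _ (hA.mem_of_mem hu ht)
  obtain ⟨M, hM0, hM⟩ := hφ.exists_variational hK'
  rw [(hφ.hasFDerivAt hK' hM0 hM ht).fderiv]
  refine ⟨det_variational hM0 hM ht, fun v => hc _ (Real.exp_pos _).le _ _ ?_⟩
  have := exp_mul_vallisNormSq_le hB hΛC hΛ
    (fun t ht => hA.sq_add_sq_le_one hφ (hA.mem_of_mem hu ht)) hM0 hM ht v
  rwa [← Real.exp_nat_mul, show ((2 : ℕ) : ℝ) * (-Λ * t) = -(2 * Λ) * t by push_cast; ring]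

end Vallis

/-! ### The dimension estimate -/

theorem theorem1 (B C p : ℝ) (hB : 0 < B) (hC : 0 < C)
    (φ : ℝ → EuclideanSpace ℝ (Fin 3) → EuclideanSpace ℝ (Fin 3))
    (hφ : IsDynamicalSystemOf (vallisField B C p) φ)
    (A : Set (EuclideanSpace ℝ (Fin 3))) (hA : IsGlobalBAttractor φ A) :
    lyapunovDim φ A ≤
      3 - 2 * (C + 2) / (C + 1 + Real.sqrt ((C - 1) ^ 2 + 25 / 4 * B)) := by
  set s := Real.sqrt ((C - 1) ^ 2 + 25 / 4 * B) with hs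
  set r := Real.sqrt ((C - 1) ^ 2 + 4 * B) with hr
  have hr2 : r ^ 2 = (C - 1) ^ 2 + 4 * B := Real.sq_sqrt (by positivity)
  have hr0 : 0 ≤ r := Real.sqrt_nonneg _
  have hrs : r < s := Real.sqrt_lt_sqrt (by positivity) (by linarith)
  have hrabs : |C - 1| < r := by
    refine abs_lt_of_sq_lt_sq ?_ hr0
    linarith
  obtain ⟨hr1, hr1'⟩ := abs_lt.1 hrabs
  set Λ := (C + 1 + r) / 2 with hΛ
  set η := 2 * (C + 2) / (C + 1 + s) with hη
  have hden : 0 < C + 1 + s := by linarith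
  have hη0 : 0 < η := by positivity
  -- Makes the bound `3 - η` nonnegative, so `d > 3 - η` forces `3 - d ≤ 3`.
  have hη3 : η ≤ 3 := by rw [hη, div_le_iff₀ hden]; linarith
  have hΛη : Λ * η < C + 2 := by
    have : η * (C + 1 + s) = 2 * (C + 2) := by rw [hη]; field_simp
    rw [hΛ]; nlinarith
  have hΛ0 : 0 < Λ := by rw [hΛ]; linarith
  obtain ⟨c, hc0, hc1, hc⟩ := exists_forall_le_norm_fderiv hB (Λ := Λ) (by rw [hΛ]; linarith)
    (by rw [hΛ]; nlinarith) hφ hA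
  -- The cube is the worst case of `c ^ (3 - d)`, since `c ≤ 1`.
  have hev : ∀ᶠ t : ℝ in atTop, Real.exp (-((C + 2 - Λ * η) * t)) < c ^ 3 := by
    have h1 : Tendsto (fun t : ℝ => (C + 2 - Λ * η) * t) atTop atTop :=
      tendsto_id.const_mul_atTop (by linarith)
    exact (Real.tendsto_exp_neg_atTop_nhds_zero.comp h1).eventually (gt_mem_nhds (by positivity))
  obtain ⟨t, ht, ht0⟩ := (hev.and (eventually_gt_atTop 0)).exists
  refine lyapunovDim_le hA.nonempty ht0 fun u hu => ?_
  obtain ⟨hdet, hlow⟩ := hc u hu t ht0.le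
  refine localLyapunovDim_le (m := c * Real.exp (-Λ * t)) (by positivity) (by linarith) hlow ?_
  intro d hd hd3
  simp only [finrank_euclideanSpace_fin] at hd3 ⊢
  push_cast at hd3 ⊢
  rw [hdet, abs_of_pos (Real.exp_pos _), Real.mul_rpow hc0.le (Real.exp_pos _).le, ← Real.exp_mul]
  have h1 : c ^ 3 ≤ c ^ (3 - d) := by
    rw [← Real.rpow_natCast]
    exact Real.rpow_le_rpow_of_exponent_ge hc0 hc1 (by push_cast; linarith)
  have h2 : Real.exp (-(Λ * η) * t) ≤ Real.exp (-Λ * t * (3 - d)) := by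
    refine Real.exp_le_exp.2 ?_
    have : Λ * t * (3 - d) ≤ Λ * t * η := by gcongr; linarith
    linarith
  calc Real.exp (-(C + 2) * t)
      = Real.exp (-((C + 2 - Λ * η) * t)) * Real.exp (-(Λ * η) * t) := by
        rw [← Real.exp_add]; ring_nf
    _ < c ^ 3 * Real.exp (-(Λ * η) * t) := by gcongr
    _ ≤ _ := by gcongr
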